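/- Let $p\ge 1$, and put $$j=\begin{bmatrix} I_p&0\\0&-I_p\end{bmatrix},\qquad J=\begin{bmatrix}0&I_p\\I_p&0\end{bmatrix},\qquad K=\frac1{\sqrt2}\begin{bmatrix}I_p&-I_p\\I_p&I_p\end{bmatrix},\qquad \mathbb C_-=\{\lambda\in\mathbb C:\ \operatorname{Im}\lambda<0\}.$$ A discrete Dirac system on $0\le k\le M$ is a recursion $$W_{k+1}(\lambda)-W_k(\lambda)=-\frac{i}{\lambda}\,jC_kW_k(\lambda)\qquad(0\le k\le M),\qquad W_0(\lambda)=I_{2p},$$ whose potentials $C_k$ ($2p\times 2p$ complex matrices) satisfy $$C_k=2K^*\beta(k)^*\beta(k)K-j,\qquad \beta(k)J\beta(k)^*=I_p\qquad(0\le k\le M)\tag{1}$$ for some $p\times 2p$ matrices $\beta(k)$. Put $\mathcal W(\lambda)=KW_{M+1}(\overline\lambda)^*$, with $p\times p$ blocks $\mathcal W_{ab}(\lambda)$, $a,b\in\{1,2\}$. A $p\times p$ matrix function $\varphi$ holomorphic in $\mathbb C_-$ is called a Weyl function of the system (on $0\le k\le M$) if, as a meromorphic function in $\mathbb C_-$,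 $$\varphi(\lambda)=i\big(\mathcal W_{21}(\lambda)R(\lambda)+\mathcal W_{22}(\lambda)Q(\lambda)\big)\big(\mathcal W_{11}(\lambda)R(\lambda)+\mathcal W_{12}(\lambda)Q(\lambda)\big)^{-1}$$ for some $p\times p$ matrix functions $R,Q$ that are meromorphic in $\mathbb C_-$, analytic at $\lambda=-i$, and satisfy $$R(\lambda)^*R(\lambda)+Q(\lambda)^*Q(\lambda)>0,\qquad R(\lambda)^*R(\lambda)\le Q(\lambda)^*Q(\lambda)$$ at $\lambda=-i$ and at all $\lambda\in\mathbb C_-$ outside a discrete set. **Theorem (Borg–Marchenko type).** Let $\widetilde\varphi$ and $\widehat\varphi$ be Weyl functions of two discrete Dirac systems satisfying (1), with the same $p$: the first with potentials $\widetilde C_k$ $(0\le k\le\widetilde N)$, the second with potentials $\widehat C_k$ $(0\le k\le\widehat N)$. Let $\{\widetilde\alpha_k\}_{k\ge0}$ and $\{\widehat\alpha_k\}_{k\ge0}$ be the Taylor coefficients at $z=0$ of $$i\,\widetilde\varphi\Big(i\,\frac{z+1}{z-1}\Big)\qquad\text{and}\qquad i\,\widehat\varphi\Big(i\,\frac{z+1}{z-1}\Big),$$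 respectively, and assume that $\widetilde\alpha_k=\widehat\alpha_k$ for all $0\le k\le N$, where $N\le\min\{\widetilde N,\widehat N\}$. Then $\widetilde C_k=\widehat C_k$ for all $0\le k\le N$. -/

import Mathlib

namespace DiscreteDirac

noncomputable section

open scoped ComplexOrder

/-- `2p × 2p` complex matrices, written in `p × p` blocks. -/
abbrev BlockMat (p : ℕ) : Type := Matrix (Fin p ⊕ Fin p) (Fin p ⊕ Fin p) ℂ

/-- `j = diag (I_p, -I_p)`. -/
def jMat (p : ℕ) : BlockMat p := Matrix.fromBlocks 1 0 0 (-1)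

/-- `J = [[0, I_p], [I_p, 0]]`. -/
def JMat (p : ℕ) : BlockMat p := Matrix.fromBlocks 0 1 1 0

/-- The unitary matrix `K = (1/√2) [[I_p, -I_p], [I_p, I_p]]`. -/
def KMat (p : ℕ) : BlockMat p :=
  ((1 / Real.sqrt 2 : ℝ) : ℂ) • Matrix.fromBlocks 1 (-1) 1 1

/-- The conditions on the potentials `C_k` of a discrete Dirac system on `0 ≤ k ≤ N`:
`C_k = 2 K* β(k)* β(k) K - j` with `p × 2p` matrices `β(k)` such that `β(k) J β(k)* = I_p`.
(The values of `C` beyond `N` are irrelevant.) -/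
def IsPotential {p : ℕ} (N : ℕ) (C : ℕ → BlockMat p) : Prop :=
  ∃ β : ℕ → Matrix (Fin p) (Fin p ⊕ Fin p) ℂ, ∀ k ≤ N,
    C k = (2 : ℂ) • ((KMat p).conjTranspose * (β k).conjTranspose * β k * KMat p) - jMat p ∧
    β k * JMat p * (β k).conjTranspose = 1

/-- The fundamental solution normalized by `W_0(μ) = I` of the discrete Dirac system
`W_{k+1}(μ) - W_k(μ) = -(i/μ) j C_k W_k(μ)`. -/
def fundSol {p : ℕ} (C : ℕ → BlockMat p) (μ : ℂ) : ℕ → BlockMat p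
  | 0 => 1
  | k + 1 => fundSol C μ k - (Complex.I / μ) • (jMat p * C k * fundSol C μ k)

/-- The coefficient matrix `𝒲(μ) = K W_{N+1}(conj μ)*` of the Möbius transformation. -/
def mobiusCoeff {p : ℕ} (C : ℕ → BlockMat p) (N : ℕ) (μ : ℂ) : BlockMat p :=
  KMat p * (fundSol C (starRingEnd ℂ μ) (N + 1)).conjTranspose

/-- The open lower half-plane. -/
def lowerHalfPlane : Set ℂ := {μ : ℂ | μ.im < 0}

/-- The inequalities `R* R + Q* Q > 0` and `R* R ≤ Q* Q`. -/
def PairIneq {p : ℕ} (R Q : Matrix (Fin p) (Fin p) ℂ) : Prop :=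
  (R.conjTranspose * R + Q.conjTranspose * Q).PosDef ∧
  (Q.conjTranspose * Q - R.conjTranspose * R).PosSemidef

/-- A pair `R`, `Q` of `p × p` matrix functions that is meromorphic in the lower half-plane,
well-defined at `-i`, and nonsingular with the `j`-property. The inequalities are required at
`-i` and at all points of the half-plane outside some discrete set (which accounts for poles,
where the value of a function is meaningless). -/
structure IsAdmissiblePair {p : ℕ} (R Q : ℂ → Matrix (Fin p) (Fin p) ℂ) : Prop where
  meromorphic_R : ∀ a b, MeromorphicOn (fun μ => R μ a b) lowerHalfPlane
  meromorphic_Q : ∀ a b, MeromorphicOn (fun μ => Q μ a b) lowerHalfPlane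
  analytic_R : ∀ a b, AnalyticAt ℂ (fun μ => R μ a b) (-Complex.I)
  analytic_Q : ∀ a b, AnalyticAt ℂ (fun μ => Q μ a b) (-Complex.I)
  ineq_at : PairIneq (R (-Complex.I)) (Q (-Complex.I))
  ineq : ∀ᶠ μ in Filter.codiscreteWithin lowerHalfPlane, PairIneq (R μ) (Q μ)

/-- `φ` is a Weyl function, on the interval `0 ≤ k ≤ N`, of the system with potentials `C_k`:
it is holomorphic in the lower half-plane and, as a meromorphic function,
`φ = i (𝒲₂₁ R + 𝒲₂₂ Q) (𝒲₁₁ R + 𝒲₁₂ Q)⁻¹` for some admissible pair `R`, `Q`. -/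
def IsWeylFunction {p : ℕ} (C : ℕ → BlockMat p) (N : ℕ)
    (φ : ℂ → Matrix (Fin p) (Fin p) ℂ) : Prop :=
  (∀ a b, DifferentiableOn ℂ (fun μ => φ μ a b) lowerHalfPlane) ∧
  ∃ R Q : ℂ → Matrix (Fin p) (Fin p) ℂ, IsAdmissiblePair R Q ∧
    ∀ᶠ μ in Filter.codiscreteWithin lowerHalfPlane,
      φ μ = Complex.I •
        (((mobiusCoeff C N μ).toBlocks₂₁ * R μ + (mobiusCoeff C N μ).toBlocks₂₂ * Q μ) *
          ((mobiusCoeff C N μ).toBlocks₁₁ * R μ + (mobiusCoeff C N μ).toBlocks₁₂ * Q μ)⁻¹)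

/-- The `k`-th Taylor coefficient (a `p × p` matrix) at `z = 0` of
`i φ (i (z + 1) / (z - 1))`. -/
def taylorCoeff {p : ℕ} (φ : ℂ → Matrix (Fin p) (Fin p) ℂ) (k : ℕ) :
    Matrix (Fin p) (Fin p) ℂ :=
  Matrix.of fun a b =>
    iteratedDeriv k
      (fun z : ℂ => Complex.I * φ (Complex.I * ((z + 1) / (z - 1))) a b) 0 / (k.factorial : ℂ)

end

end DiscreteDirac

/-!
The conditions on the potentials make `P_k = (1 + C_k j) / 2` a fundamental projection of the Krein
space with Gram matrix `j`. With `μ = i (z + 1) / (z - 1)`, the matrix `W_n(conj μ)*` is a scalar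
multiple of the Blaschke–Potapov product of the factors `(1 - P_k) + z P_k`, `k < n`.

In the coordinates given by `K` and up to the factor `i`, a Weyl function is the angular operator of
the column space of this product applied to a frame that is `j`-nonpositive at `z = 0`. At `z = 0`,
that is at `μ = -i`, the first factor is `1 - P_0`; by a dimension count the column space is then
all of `ker P_0`, which determines `P_0` and hence `C_0`. Thus the zeroth Taylor coefficient
determines `C_0`. Multiplying by `z (1 - P_0) + P_0` replaces the first factor by the scalar `z`, so
cancelling it costs one power of `z`, that is one Taylor coefficient, and the argument repeats with
`C_1`.
-/

namespace DiscreteDirac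

open scoped ComplexOrder
open Matrix Filter Topology

section FundamentalProjection

variable {𝕜 n m : Type*} [RCLike 𝕜] [Fintype n] [Fintype m] {j P Q : Matrix n n 𝕜}

/-- A fundamental projection of the Krein space `𝕜ⁿ` with indefinite form `⟨x, y⟩ = x* j y`: a
projection, self-adjoint for this form, whose range is nonnegative (`j P ≥ 0`) and whose kernel is
nonpositive (`j (1 - P) ≤ 0`). -/
structure IsFundamentalProjection (j P : Matrix n n 𝕜) : Prop where
  isIdempotentElem : IsIdempotentElem P
  posSemidef_mul : (j * P).PosSemidef
  posSemidef_mul_sub : (j * P - j).PosSemidef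

/-- The columns of `V` form a basis of a subspace on which the form `x* j x` is nonpositive. -/
structure IsNonposFrame (j : Matrix n n 𝕜) (V : Matrix n m 𝕜) : Prop where
  mulVec_injective : Function.Injective V.mulVec
  posSemidef_neg : (-(Vᴴ * j * V)).PosSemidef

lemma star_mulVec_dotProduct_mulVec_mulVec (j : Matrix n n 𝕜) (V : Matrix n m 𝕜) (v : m → 𝕜) :
    star (V *ᵥ v) ⬝ᵥ j *ᵥ (V *ᵥ v) = star v ⬝ᵥ (Vᴴ * j * V) *ᵥ v := by
  rw [star_mulVec, ← dotProduct_mulVec, mulVec_mulVec, mulVec_mulVec]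

lemma IsNonposFrame.form_nonpos {V : Matrix n m 𝕜} (hV : IsNonposFrame j V) (v : m → 𝕜) :
    star (V *ᵥ v) ⬝ᵥ j *ᵥ (V *ᵥ v) ≤ 0 := by
  have h := hV.posSemidef_neg.dotProduct_mulVec_nonneg v
  rwa [neg_mulVec, dotProduct_neg, neg_nonneg, ← star_mulVec_dotProduct_mulVec_mulVec] at h

lemma IsNonposFrame.mulVec_eq_zero_iff {V : Matrix n m 𝕜} (hV : IsNonposFrame j V) {v : m → 𝕜} :
    V *ᵥ v = 0 ↔ v = 0 :=
  map_eq_zero_iff V.mulVecLin hV.mulVec_injective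

namespace IsFundamentalProjection

lemma isHermitian (hP : IsFundamentalProjection j P) : j.IsHermitian := by
  simpa using hP.posSemidef_mul.isHermitian.sub hP.posSemidef_mul_sub.isHermitian

lemma mul_eq_conjTranspose_mul (hP : IsFundamentalProjection j P) : j * P = Pᴴ * j := by
  have h := hP.posSemidef_mul.isHermitian.eq
  rwa [conjTranspose_mul, hP.isHermitian.eq, eq_comm] at h

variable [DecidableEq n]

lemma eq_zero_of_mulVec_eq_zero (hP : IsFundamentalProjection j P) (hj : IsUnit j) {x : n → 𝕜}
    (hx : P *ᵥ x = 0) (h : 0 ≤ star x ⬝ᵥ j *ᵥ x) : x = 0 := by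
  have hjx : (j * P - j) *ᵥ x = -(j *ᵥ x) := by
    rw [sub_mulVec, ← mulVec_mulVec, hx, mulVec_zero, zero_sub]
  have hform : star x ⬝ᵥ (j * P - j) *ᵥ x = 0 := by
    refine le_antisymm ?_ (hP.posSemidef_mul_sub.dotProduct_mulVec_nonneg x)
    rwa [hjx, dotProduct_neg, neg_nonpos]
  rw [hP.posSemidef_mul_sub.dotProduct_mulVec_zero_iff, hjx, neg_eq_zero] at hform
  exact Matrix.eq_zero_of_mulVec_eq_zero ((isUnit_iff_isUnit_det j).1 hj).ne_zero hform

lemma eq_zero_of_mulVec_eq_self (hP : IsFundamentalProjection j P) (hj : IsUnit j) {x : n → 𝕜}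
    (hx : P *ᵥ x = x) (h : star x ⬝ᵥ j *ᵥ x ≤ 0) : x = 0 := by
  have hjx : (j * P) *ᵥ x = j *ᵥ x := by rw [← mulVec_mulVec, hx]
  have hform : star x ⬝ᵥ (j * P) *ᵥ x = 0 :=
    le_antisymm (hjx ▸ h) (hP.posSemidef_mul.dotProduct_mulVec_nonneg x)
  rw [hP.posSemidef_mul.dotProduct_mulVec_zero_iff, hjx] at hform
  exact Matrix.eq_zero_of_mulVec_eq_zero ((isUnit_iff_isUnit_det j).1 hj).ne_zero hform

lemma mul_one_sub_mul {k : Type*} (hP : IsFundamentalProjection j P) (V : Matrix n k 𝕜) :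
    P * ((1 - P) * V) = 0 := by
  rw [← Matrix.mul_assoc, hP.isIdempotentElem.mul_one_sub_self, Matrix.zero_mul]

lemma isNonposFrame_one_sub_mul (hP : IsFundamentalProjection j P) (hj : IsUnit j)
    {V : Matrix n m 𝕜} (hV : IsNonposFrame j V) : IsNonposFrame j ((1 - P) * V) where
  mulVec_injective := by
    refine (injective_iff_map_eq_zero ((1 - P) * V).mulVecLin).2 fun v hv => ?_
    have hPVv : P *ᵥ (V *ᵥ v) = V *ᵥ v := by
      rw [mulVecLin_apply, ← mulVec_mulVec, sub_mulVec, one_mulVec, sub_eq_zero] at hv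
      exact hv.symm
    exact hV.mulVec_eq_zero_iff.1 (hP.eq_zero_of_mulVec_eq_self hj hPVv (hV.form_nonpos v))
  posSemidef_neg := by
    have h := hP.posSemidef_mul_sub.conjTranspose_mul_mul_same ((1 - P) * V)
    rwa [Matrix.mul_sub, Matrix.sub_mul, Matrix.mul_assoc, Matrix.mul_assoc j,
      hP.mul_one_sub_mul, Matrix.mul_zero, Matrix.mul_zero, zero_sub] at h

/-- Self-adjointness makes the range of `P` the `j`-orthogonal complement of its kernel, so that
the kernel determines `P`. -/
lemma eq_of_mul_one_sub_eq_zero (hP : IsFundamentalProjection j P)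
    (hQ : IsFundamentalProjection j Q) (hj : IsUnit j) (hPQ : P * (1 - Q) = 0)
    (hQP : Q * (1 - P) = 0) : P = Q := by
  rw [Matrix.mul_sub, Matrix.mul_one, sub_eq_zero] at hPQ hQP
  refine hj.mul_left_cancel ?_
  calc j * P = (P * Q)ᴴ * j := by rw [← hPQ, hP.mul_eq_conjTranspose_mul]
    _ = Qᴴ * (j * P) := by
      rw [conjTranspose_mul, Matrix.mul_assoc, hP.mul_eq_conjTranspose_mul]
    _ = j * Q := by
      rw [← Matrix.mul_assoc, ← hQ.mul_eq_conjTranspose_mul, Matrix.mul_assoc, ← hQP]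

end IsFundamentalProjection

end FundamentalProjection

section Signature

variable {𝕜 m n : Type*} [RCLike 𝕜] [DecidableEq m] [DecidableEq n]

/-- The Gram matrix `diag (1, -1)` of the indefinite form `|x₁|² - |x₂|²` on `𝕜ᵐ × 𝕜ⁿ`; the matrix
`j` of a Dirac system is `signatureMatrix ℂ (Fin p) (Fin p)`. -/
abbrev signatureMatrix (𝕜 m n : Type*) [RCLike 𝕜] [DecidableEq m] [DecidableEq n] :
    Matrix (m ⊕ n) (m ⊕ n) 𝕜 :=
  fromBlocks 1 0 0 (-1)

lemma signatureMatrix_conjTranspose : (signatureMatrix 𝕜 m n)ᴴ = signatureMatrix 𝕜 m n := by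
  simp [fromBlocks_conjTranspose]

variable [Fintype m] [Fintype n]

lemma signatureMatrix_mul_self : signatureMatrix 𝕜 m n * signatureMatrix 𝕜 m n = 1 := by
  simp [fromBlocks_multiply]

lemma isUnit_signatureMatrix : IsUnit (signatureMatrix 𝕜 m n) :=
  .of_mul_eq_one _ signatureMatrix_mul_self

lemma conjTranspose_mul_signatureMatrix_mul {k : Type*} (V : Matrix (m ⊕ n) k 𝕜) :
    Vᴴ * signatureMatrix 𝕜 m n * V = V.toRows₁ᴴ * V.toRows₁ - V.toRows₂ᴴ * V.toRows₂ := by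
  rw [← fromRows_toRows V, conjTranspose_fromRows_eq_fromCols_conjTranspose,
    fromCols_mul_fromBlocks, fromCols_mul_fromRows]
  simp [sub_eq_add_neg]

lemma star_dotProduct_signatureMatrix_mulVec (x : m ⊕ n → 𝕜) :
    star x ⬝ᵥ signatureMatrix 𝕜 m n *ᵥ x =
      star (x ∘ Sum.inl) ⬝ᵥ (x ∘ Sum.inl) - star (x ∘ Sum.inr) ⬝ᵥ (x ∘ Sum.inr) := by
  simp [fromBlocks_mulVec, dotProduct, neg_mulVec, sub_eq_add_neg]

lemma isUnit_toRows₁_of_conjTranspose_mul_eq_one {V : Matrix (m ⊕ n) m 𝕜}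
    (hV : Vᴴ * signatureMatrix 𝕜 m n * V = 1) : IsUnit V.toRows₁ := by
  rw [conjTranspose_mul_signatureMatrix_mul, sub_eq_iff_eq_add] at hV
  have hpos : (V.toRows₁ᴴ * V.toRows₁).PosDef :=
    hV ▸ PosDef.one.add_posSemidef (posSemidef_conjTranspose_mul_self _)
  exact isUnit_of_mul_isUnit_right hpos.isUnit

/-- Subtracting from `1` a matrix `V * L` with the same first rows leaves rows on which the form is
nonpositive; expanding that form and completing the square gives the claim. -/
lemma posSemidef_signatureMatrix_mul_sub {V : Matrix (m ⊕ n) m 𝕜}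
    (hV : Vᴴ * signatureMatrix 𝕜 m n * V = 1) :
    (signatureMatrix 𝕜 m n * (V * Vᴴ * signatureMatrix 𝕜 m n) -
      signatureMatrix 𝕜 m n).PosSemidef := by
  set j := signatureMatrix 𝕜 m n with hj
  set L : Matrix m (m ⊕ n) 𝕜 := V.toRows₁⁻¹ * toRows₁ (1 : Matrix (m ⊕ n) (m ⊕ n) 𝕜)
  set Z : Matrix (m ⊕ n) (m ⊕ n) 𝕜 := 1 - V * L
  have hZ : Z.toRows₁ = 0 := by
    have hunit := (isUnit_iff_isUnit_det _).1 (isUnit_toRows₁_of_conjTranspose_mul_eq_one hV)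
    have hVL : (V * L).toRows₁ = V.toRows₁ * L := rfl
    change toRows₁ (1 : Matrix (m ⊕ n) (m ⊕ n) 𝕜) - (V * L).toRows₁ = 0
    rw [hVL, mul_nonsing_inv_cancel_left _ _ hunit, sub_self]
  have hform : Zᴴ * j * Z = -(Z.toRows₂ᴴ * Z.toRows₂) := by
    rw [hj, conjTranspose_mul_signatureMatrix_mul, hZ, Matrix.mul_zero, zero_sub]
  have hexpand : Zᴴ * j * Z = j - j * V * L - Lᴴ * (Vᴴ * j) + Lᴴ * (Vᴴ * j * V) * L := by
    simp only [Z, conjTranspose_sub, conjTranspose_mul, conjTranspose_one, Matrix.mul_sub,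
      Matrix.sub_mul, Matrix.mul_assoc, Matrix.one_mul, Matrix.mul_one]
    abel
  have hsquare : j * (V * Vᴴ * j) - j =
      Z.toRows₂ᴴ * Z.toRows₂ + (L - Vᴴ * j)ᴴ * (L - Vᴴ * j) := by
    rw [← neg_eq_iff_eq_neg.2 hform, hexpand, hV]
    simp only [conjTranspose_sub, conjTranspose_mul, conjTranspose_conjTranspose,
      signatureMatrix_conjTranspose, j, Matrix.mul_sub, Matrix.sub_mul, Matrix.mul_assoc,
      Matrix.one_mul]
    abel
  rw [hsquare]
  exact (posSemidef_conjTranspose_mul_self _).add (posSemidef_conjTranspose_mul_self _)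

lemma isFundamentalProjection_mul_conjTranspose_mul {V : Matrix (m ⊕ n) m 𝕜}
    (hV : Vᴴ * signatureMatrix 𝕜 m n * V = 1) :
    IsFundamentalProjection (signatureMatrix 𝕜 m n) (V * Vᴴ * signatureMatrix 𝕜 m n) where
  isIdempotentElem := by
    calc V * Vᴴ * signatureMatrix 𝕜 m n * (V * Vᴴ * signatureMatrix 𝕜 m n)
        = V * (Vᴴ * signatureMatrix 𝕜 m n * V) * Vᴴ * signatureMatrix 𝕜 m n := by
          simp only [Matrix.mul_assoc]
      _ = V * Vᴴ * signatureMatrix 𝕜 m n := by rw [hV, Matrix.mul_one]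
  posSemidef_mul := by
    have h := posSemidef_conjTranspose_mul_self (Vᴴ * signatureMatrix 𝕜 m n)
    rwa [conjTranspose_mul, conjTranspose_conjTranspose, signatureMatrix_conjTranspose,
      Matrix.mul_assoc, ← Matrix.mul_assoc V] at h
  posSemidef_mul_sub := posSemidef_signatureMatrix_mul_sub hV

lemma IsNonposFrame.isUnit_toRows₂ {V : Matrix (m ⊕ n) n 𝕜}
    (hV : IsNonposFrame (signatureMatrix 𝕜 m n) V) : IsUnit V.toRows₂ := by
  refine mulVec_injective_iff_isUnit.1
    ((injective_iff_map_eq_zero V.toRows₂.mulVecLin).2 fun v hv => hV.mulVec_eq_zero_iff.1 ?_)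
  have h₂ : (V *ᵥ v) ∘ Sum.inr = 0 := hv
  have h₁ : (V *ᵥ v) ∘ Sum.inl = 0 := by
    have h := hV.form_nonpos v
    rw [star_dotProduct_signatureMatrix_mulVec, h₂, dotProduct_zero, sub_zero] at h
    exact dotProduct_star_self_eq_zero.1 (h.antisymm (dotProduct_star_self_nonneg _))
  ext (i | i)
  exacts [congrFun h₁ i, congrFun h₂ i]

/-- A nonpositive frame with `n` columns inside the kernel of a fundamental projection spans it:
some vector of its span has the same second component, and the difference of the two lies in the
kernel with nonnegative form. -/
lemma IsFundamentalProjection.exists_mulVec_eq {P : Matrix (m ⊕ n) (m ⊕ n) 𝕜}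
    (hP : IsFundamentalProjection (signatureMatrix 𝕜 m n) P) {V : Matrix (m ⊕ n) n 𝕜}
    (hV : IsNonposFrame (signatureMatrix 𝕜 m n) V) (hPV : P * V = 0) {x : m ⊕ n → 𝕜}
    (hx : P *ᵥ x = 0) : ∃ v, V *ᵥ v = x := by
  obtain ⟨v, hv⟩ := mulVec_surjective_iff_isUnit.2 hV.isUnit_toRows₂ (x ∘ Sum.inr)
  have h₂ : (V *ᵥ v - x) ∘ Sum.inr = 0 := by
    rw [Pi.sub_comp, sub_eq_zero]
    exact hv
  refine ⟨v, sub_eq_zero.1 (hP.eq_zero_of_mulVec_eq_zero isUnit_signatureMatrix ?_ ?_)⟩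
  · rw [mulVec_sub, mulVec_mulVec, hPV, zero_mulVec, hx, sub_zero]
  · rw [star_dotProduct_signatureMatrix_mulVec, h₂, dotProduct_zero, sub_zero]
    exact dotProduct_star_self_nonneg _

lemma IsFundamentalProjection.eq_of_mul_eq_zero {P Q : Matrix (m ⊕ n) (m ⊕ n) 𝕜}
    (hP : IsFundamentalProjection (signatureMatrix 𝕜 m n) P)
    (hQ : IsFundamentalProjection (signatureMatrix 𝕜 m n) Q) {V : Matrix (m ⊕ n) n 𝕜}
    (hV : IsNonposFrame (signatureMatrix 𝕜 m n) V) (hPV : P * V = 0) (hQV : Q * V = 0) :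
    P = Q := by
  have hker {P Q : Matrix (m ⊕ n) (m ⊕ n) 𝕜}
      (hP : IsFundamentalProjection (signatureMatrix 𝕜 m n) P) (hPV : P * V = 0)
      (hQV : Q * V = 0) : Q * (1 - P) = 0 := by
    refine Matrix.ext_iff_mulVec.2 fun x => ?_
    obtain ⟨v, hv⟩ := hP.exists_mulVec_eq hV hPV (x := (1 - P) *ᵥ x) <| by
      rw [mulVec_mulVec, hP.isIdempotentElem.mul_one_sub_self, zero_mulVec]
    rw [← mulVec_mulVec, ← hv, mulVec_mulVec, hQV, zero_mulVec, zero_mulVec]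
  exact hP.eq_of_mul_one_sub_eq_zero hQ isUnit_signatureMatrix (hker hQ hQV hPV)
    (hker hP hPV hQV)

/-- The form vanishes at a vector whose two components are equal. -/
lemma IsFundamentalProjection.isUnit_toRows₁_sub_toRows₂ {P : Matrix (n ⊕ n) (n ⊕ n) 𝕜}
    (hP : IsFundamentalProjection (signatureMatrix 𝕜 n n) P) {V : Matrix (n ⊕ n) n 𝕜}
    (hV : IsNonposFrame (signatureMatrix 𝕜 n n) V) (hPV : P * V = 0) :
    IsUnit (V.toRows₁ - V.toRows₂) := by
  refine mulVec_injective_iff_isUnit.1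
    ((injective_iff_map_eq_zero (V.toRows₁ - V.toRows₂).mulVecLin).2 fun v hv =>
      hV.mulVec_eq_zero_iff.1 (hP.eq_zero_of_mulVec_eq_zero isUnit_signatureMatrix ?_ ?_))
  · rw [mulVec_mulVec, hPV, zero_mulVec]
  · have hcomp : (V *ᵥ v) ∘ Sum.inl = (V *ᵥ v) ∘ Sum.inr := by
      rw [mulVecLin_apply, sub_mulVec, sub_eq_zero] at hv
      exact hv
    rw [star_dotProduct_signatureMatrix_mulVec, hcomp, sub_self]

end Signature

section PotapovProduct

variable {𝕜 n : Type*} [RCLike 𝕜] [DecidableEq n]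

/-- The elementary Blaschke–Potapov factor `(1 - P) + z P` of a projection `P`. -/
def potapovFactor (P : Matrix n n 𝕜) (z : 𝕜) : Matrix n n 𝕜 := 1 - P + z • P

lemma potapovFactor_zero (P : Matrix n n 𝕜) : potapovFactor P 0 = 1 - P := by
  simp [potapovFactor]

lemma continuous_potapovFactor (P : Matrix n n 𝕜) : Continuous (potapovFactor P) := by
  unfold potapovFactor
  fun_prop

variable [Fintype n]

/-- The product of the first `N` factors `(1 - Pₖ) + z Pₖ`, in increasing order of `k` from left to
right. -/
def potapovProd (P : ℕ → Matrix n n 𝕜) (N : ℕ) (z : 𝕜) : Matrix n n 𝕜 :=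
  ((List.range N).map fun k => potapovFactor (P k) z).prod

lemma potapovProd_succ (P : ℕ → Matrix n n 𝕜) (N : ℕ) (z : 𝕜) :
    potapovProd P (N + 1) z = potapovProd P N z * potapovFactor (P N) z :=
  List.prod_range_succ _ _

lemma potapovProd_succ' (P : ℕ → Matrix n n 𝕜) (N : ℕ) (z : 𝕜) :
    potapovProd P (N + 1) z = potapovFactor (P 0) z * potapovProd (fun k => P (k + 1)) N z :=
  List.prod_range_succ' _ _

lemma continuous_potapovProd (P : ℕ → Matrix n n 𝕜) (N : ℕ) : Continuous (potapovProd P N) :=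
  continuous_list_prod _ fun k _ => continuous_potapovFactor (P k)

lemma smul_one_sub_add_mul_potapovFactor {P : Matrix n n 𝕜} (hP : IsIdempotentElem P) (z : 𝕜) :
    (z • (1 - P) + P) * potapovFactor P z = z • 1 := by
  have hP' := hP.eq
  simp only [potapovFactor, add_mul, mul_add, sub_mul, mul_sub, smul_mul_assoc, mul_smul_comm,
    hP', one_mul, mul_one, sub_self, smul_zero, smul_sub, smul_add]
  abel

lemma IsNonposFrame.potapovProd_zero_mul {m : Type*} [Fintype m] {j : Matrix n n 𝕜}
    (hj : IsUnit j) {V : Matrix n m 𝕜} (hV : IsNonposFrame j V) {P : ℕ → Matrix n n 𝕜} {N : ℕ}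
    (hP : ∀ k < N, IsFundamentalProjection j (P k)) : IsNonposFrame j (potapovProd P N 0 * V) := by
  induction N generalizing P with
  | zero => simpa [potapovProd] using hV
  | succ N ih =>
    rw [potapovProd_succ', potapovFactor_zero, Matrix.mul_assoc]
    exact (hP 0 N.succ_pos).isNonposFrame_one_sub_mul hj
      (ih fun k hk => hP (k + 1) (Nat.succ_lt_succ hk))

lemma potapovProd_succ_zero_mul {m : Type*} {P : ℕ → Matrix n n 𝕜} (hP : IsIdempotentElem (P 0))
    (N : ℕ) (V : Matrix n m 𝕜) : P 0 * (potapovProd P (N + 1) 0 * V) = 0 := by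
  rw [potapovProd_succ', potapovFactor_zero, ← Matrix.mul_assoc, ← Matrix.mul_assoc,
    hP.mul_one_sub_self, Matrix.zero_mul, Matrix.zero_mul]

end PotapovProduct

section LocalAnalysis

lemma nhdsNE_le_codiscreteWithin {α : Type*} [TopologicalSpace α] {s : Set α} {x : α}
    (hs : s ∈ 𝓝 x) : 𝓝[≠] x ≤ codiscreteWithin s := by
  intro t ht
  filter_upwards [mem_codiscreteWithin_iff_forall_mem_nhdsNE.1 ht x (mem_of_mem_nhds hs),
    mem_nhdsWithin_of_mem_nhds hs] with y hy hys
  exact hy.resolve_right (not_not_intro hys)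

lemma exists_eq_add_pow_smul_of_iteratedDeriv_eq {𝕜 F : Type*} [RCLike 𝕜] [NormedAddCommGroup F]
    [NormedSpace 𝕜 F] [CompleteSpace F] {f g : 𝕜 → F} {z₀ : 𝕜} {n : ℕ} (hf : AnalyticAt 𝕜 f z₀)
    (hg : AnalyticAt 𝕜 g z₀) (h : ∀ i < n, iteratedDeriv i f z₀ = iteratedDeriv i g z₀) :
    ∃ e : 𝕜 → F, AnalyticAt 𝕜 e z₀ ∧ ∀ᶠ z in 𝓝 z₀, f z = g z + (z - z₀) ^ n • e z := by
  obtain ⟨e, he, hfg⟩ := (natCast_le_analyticOrderAt (hf.sub hg)).1 <|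
    (natCast_le_analyticOrderAt_iff_iteratedDeriv_eq_zero (hf.sub hg)).2 fun i hi => by
      rw [iteratedDeriv_sub hf.contDiffAt hg.contDiffAt, h i hi, sub_self]
  exact ⟨e, he, hfg.mono fun z hz => sub_eq_iff_eq_add'.1 hz⟩

lemma eq_of_eventually_eq_add_pow_smul {𝕜 F : Type*} [NontriviallyNormedField 𝕜]
    [TopologicalSpace F] [T2Space F] [AddCommMonoid F] [Module 𝕜 F] [ContinuousAdd F]
    [ContinuousSMul 𝕜 F] {f g E : 𝕜 → F} {r : ℕ} (hf : ContinuousAt f 0) (hg : ContinuousAt g 0)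
    (hE : ContinuousAt E 0) (h : ∀ᶠ z in 𝓝[≠] 0, f z = g z + z ^ (r + 1) • E z) : f 0 = g 0 := by
  have hsum : ContinuousAt (fun z => g z + z ^ (r + 1) • E z) 0 :=
    hg.add ((continuousAt_id.pow _).smul hE)
  have hlim := tendsto_nhds_unique_of_eventuallyEq (hf.tendsto.mono_left nhdsWithin_le_nhds)
    (hsum.tendsto.mono_left nhdsWithin_le_nhds) h
  simpa using hlim

variable {α k l r R : Type*} [TopologicalSpace α] [TopologicalSpace R] {x : α}

lemma continuousAt_fromRows {A : α → Matrix k r R} {B : α → Matrix l r R} (hA : ContinuousAt A x)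
    (hB : ContinuousAt B x) : ContinuousAt (fun t => fromRows (A t) (B t)) x := by
  refine continuousAt_pi.2 ?_
  rintro (i | i)
  exacts [continuousAt_pi.1 hA i, continuousAt_pi.1 hB i]

lemma continuousAt_toRows₁ {A : α → Matrix (k ⊕ l) r R} (hA : ContinuousAt A x) :
    ContinuousAt (fun t => (A t).toRows₁) x :=
  continuousAt_pi.2 fun i => continuousAt_pi.1 hA (Sum.inl i)

variable [Fintype k] [DecidableEq k] [Field R] {A : α → Matrix k k R}

lemma eventually_isUnit_of_continuousAt [IsTopologicalRing R] [T1Space R] (hA : ContinuousAt A x)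
    (hx : IsUnit (A x)) : ∀ᶠ t in 𝓝 x, IsUnit (A t) := by
  have hdet : ContinuousAt (fun t => (A t).det) x :=
    ContinuousAt.comp (g := det) continuous_id.matrix_det.continuousAt hA
  filter_upwards [hdet.eventually_ne ((isUnit_iff_isUnit_det _).1 hx).ne_zero] with t ht
  exact (isUnit_iff_isUnit_det _).2 ht.isUnit

lemma continuousAt_nonsing_inv [IsTopologicalDivisionRing R] (hA : ContinuousAt A x)
    (hx : IsUnit (A x)) : ContinuousAt (fun t => (A t)⁻¹) x := by
  refine ContinuousAt.comp (g := Inv.inv) (continuousAt_matrix_inv _ ?_) hA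
  rw [Ring.inverse_eq_inv']
  exact continuousAt_inv₀ ((isUnit_iff_isUnit_det _).1 hx).ne_zero

end LocalAnalysis

section Uniqueness

variable {𝕜 m n : Type*} [RCLike 𝕜] [Fintype m] [Fintype n] [DecidableEq m] [DecidableEq n]

lemma eq_add_pow_smul_of_potapovFactor_mul_eq {k : Type*} {P : Matrix n n 𝕜}
    (hP : IsIdempotentElem P) {z : 𝕜} (hz : z ≠ 0) {A B E : Matrix n k 𝕜} {r : ℕ}
    (h : potapovFactor P z * A = potapovFactor P z * B + z ^ (r + 1) • E) :
    A = B + z ^ r • ((z • (1 - P) + P) * E) := by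
  have hmul := congrArg ((z • (1 - P) + P) * ·) h
  simp only [Matrix.mul_add, ← Matrix.mul_assoc, smul_one_sub_add_mul_potapovFactor hP,
    Matrix.smul_mul, Matrix.one_mul, Matrix.mul_smul] at hmul
  rw [pow_succ', mul_smul, ← smul_add] at hmul
  rw [smul_right_injective _ hz hmul, Matrix.add_mul, Matrix.smul_mul]

variable {P Q : ℕ → Matrix (m ⊕ n) (m ⊕ n) 𝕜} {X Y E : 𝕜 → Matrix (m ⊕ n) n 𝕜}
  {U : 𝕜 → Matrix n n 𝕜} {a b r : ℕ}

lemma projection_zero_eq_of_potapovProd_zero_mul_eq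
    (hP : ∀ k < a + 1, IsFundamentalProjection (signatureMatrix 𝕜 m n) (P k))
    (hQ : IsFundamentalProjection (signatureMatrix 𝕜 m n) (Q 0))
    (hX : IsNonposFrame (signatureMatrix 𝕜 m n) (X 0)) (hU : IsUnit (U 0))
    (h : potapovProd Q (b + 1) 0 * Y 0 = potapovProd P (a + 1) 0 * X 0 * U 0) : P 0 = Q 0 := by
  refine (hP 0 a.succ_pos).eq_of_mul_eq_zero hQ (hX.potapovProd_zero_mul isUnit_signatureMatrix hP)
    (potapovProd_succ_zero_mul (hP 0 a.succ_pos).isIdempotentElem a _) ?_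
  have hunit := (isUnit_iff_isUnit_det _).1 hU
  rw [← mul_nonsing_inv_cancel_right _ (potapovProd P (a + 1) 0 * X 0) hunit, ← h,
    ← Matrix.mul_assoc, potapovProd_succ_zero_mul hQ.isIdempotentElem, Matrix.zero_mul]

/-- At `z = 0` the hypothesis identifies the first projections; their common factor can then be
cancelled at the cost of one power of `z`. -/
theorem projection_eq_of_potapovProd_mul_eq (hra : r ≤ a) (hrb : r ≤ b)
    (hP : ∀ k < a, IsFundamentalProjection (signatureMatrix 𝕜 m n) (P k))
    (hQ : ∀ k < b, IsFundamentalProjection (signatureMatrix 𝕜 m n) (Q k))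
    (hXc : ContinuousAt X 0) (hYc : ContinuousAt Y 0) (hUc : ContinuousAt U 0)
    (hEc : ContinuousAt E 0) (hX : IsNonposFrame (signatureMatrix 𝕜 m n) (X 0))
    (hU : IsUnit (U 0))
    (h : ∀ᶠ z in 𝓝[≠] 0,
      potapovProd Q b z * Y z = potapovProd P a z * X z * U z + z ^ r • E z) :
    ∀ k < r, P k = Q k := by
  induction r generalizing P Q a b E with
  | zero => exact fun k hk => absurd hk k.not_lt_zero
  | succ r ih =>
    obtain ⟨a, rfl⟩ := Nat.exists_eq_add_one.2 (r.succ_pos.trans_le hra)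
    obtain ⟨b, rfl⟩ := Nat.exists_eq_add_one.2 (r.succ_pos.trans_le hrb)
    have hPc := (continuous_potapovProd P (a + 1)).continuousAt (x := 0)
    have hQc := (continuous_potapovProd Q (b + 1)).continuousAt (x := 0)
    have hat_zero := eq_of_eventually_eq_add_pow_smul (f := fun z => potapovProd Q (b + 1) z * Y z)
      (g := fun z => potapovProd P (a + 1) z * X z * U z) (by fun_prop) (by fun_prop) hEc h
    have hfirst : P 0 = Q 0 :=
      projection_zero_eq_of_potapovProd_zero_mul_eq hP (hQ 0 b.succ_pos) hX hU hat_zero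
    have htail : ∀ᶠ z in 𝓝[≠] 0, potapovProd (fun k => Q (k + 1)) b z * Y z =
        potapovProd (fun k => P (k + 1)) a z * X z * U z +
          z ^ r • ((z • (1 - P 0) + P 0) * E z) := by
      filter_upwards [h, self_mem_nhdsWithin] with z hz hz0
      refine eq_add_pow_smul_of_potapovFactor_mul_eq (hP 0 a.succ_pos).isIdempotentElem hz0 ?_
      simpa only [potapovProd_succ', ← hfirst, Matrix.mul_assoc] using hz
    rintro (_ | k) hk
    · exact hfirst
    · exact ih (Nat.le_of_succ_le_succ hra) (Nat.le_of_succ_le_succ hrb)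
        (fun k hk => hP (k + 1) (Nat.succ_lt_succ hk))
        (fun k hk => hQ (k + 1) (Nat.succ_lt_succ hk)) (by fun_prop) htail k
        (Nat.lt_of_succ_lt_succ hk)

end Uniqueness

section BlockQuotient

variable {𝕜 m n : Type*} [Field 𝕜] [Fintype n] [DecidableEq n]

/-- The quotient `Z₂ Z₁⁻¹` of the two blocks of rows of `Z`: the linear map whose graph is the
column space of `Z`, provided that `Z₁` is invertible (otherwise `Z₁⁻¹ = 0`). -/
noncomputable def blockQuotient (Z : Matrix (n ⊕ m) n 𝕜) : Matrix m n 𝕜 := Z.toRows₂ * Z.toRows₁⁻¹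

lemma blockQuotient_smul {c : 𝕜} (hc : c ≠ 0) {Z : Matrix (n ⊕ m) n 𝕜} (hZ : IsUnit Z.toRows₁) :
    blockQuotient (c • Z) = blockQuotient Z := by
  have := invertibleOfNonzero hc
  change c • Z.toRows₂ * (c • Z.toRows₁)⁻¹ = _
  rw [inv_smul _ c ((isUnit_iff_isUnit_det _).1 hZ), Matrix.mul_smul, Matrix.smul_mul, smul_smul,
    invOf_mul_self, one_smul, blockQuotient]

lemma fromRows_one_blockQuotient_mul {Z : Matrix (n ⊕ m) n 𝕜} (hZ : IsUnit Z.toRows₁) :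
    fromRows 1 (blockQuotient Z) * Z.toRows₁ = Z := by
  rw [fromRows_mul, Matrix.one_mul, blockQuotient,
    nonsing_inv_mul_cancel_right _ _ ((isUnit_iff_isUnit_det _).1 hZ), fromRows_toRows]

lemma blockQuotient_mul_fromRows [Fintype m] (A : Matrix (n ⊕ m) (n ⊕ m) 𝕜) (R : Matrix n n 𝕜)
    (Q : Matrix m n 𝕜) :
    blockQuotient (A * fromRows R Q) = (A.toBlocks₂₁ * R + A.toBlocks₂₂ * Q) *
      (A.toBlocks₁₁ * R + A.toBlocks₁₂ * Q)⁻¹ := by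
  conv_lhs => rw [← fromBlocks_toBlocks A, fromBlocks_mul_fromRows]
  simp only [blockQuotient, toRows₁_fromRows, toRows₂_fromRows]

lemma mul_fromRows_one_mul_eq_add_smul [Fintype m] {A : Matrix (n ⊕ m) (n ⊕ m) 𝕜}
    {S T G : Matrix m n 𝕜} {D D' : Matrix n n 𝕜} {c : 𝕜} (hD : IsUnit D) (h : S = T + c • G) :
    A * fromRows (1 : Matrix n n 𝕜) (-T) * D' =
      A * fromRows (1 : Matrix n n 𝕜) (-S) * D * (D⁻¹ * D') +
        c • (A * fromRows (0 : Matrix n n 𝕜) G * D') := by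
  have hrows : fromRows (1 : Matrix n n 𝕜) (-T) =
      fromRows (1 : Matrix n n 𝕜) (-S) + c • fromRows (0 : Matrix n n 𝕜) G := by
    subst h
    ext (i | i) k <;> simp
  rw [hrows, ← Matrix.mul_assoc, mul_nonsing_inv_cancel_right _ _ ((isUnit_iff_isUnit_det _).1 hD),
    Matrix.mul_add, Matrix.add_mul, Matrix.mul_smul, Matrix.smul_mul]

end BlockQuotient

section Potential

variable {p N : ℕ} {C : ℕ → BlockMat p}

/-- The projection `P = (1 + C j) / 2` encoding a potential `C = (2 P - 1) j`. -/
noncomputable def potentialProj (C : BlockMat p) : BlockMat p := (2⁻¹ : ℂ) • (1 + C * jMat p)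

lemma jMat_mul_jMat : jMat p * jMat p = 1 := signatureMatrix_mul_self

lemma potentialProj_injective : Function.Injective (potentialProj (p := p)) := by
  intro C C' h
  have h' := add_left_cancel (smul_right_injective _ (inv_ne_zero (two_ne_zero' ℂ)) h)
  exact (isUnit_signatureMatrix (𝕜 := ℂ)).mul_right_cancel h'

lemma one_div_sqrt_two_mul_self :
    ((1 / Real.sqrt 2 : ℝ) : ℂ) * ((1 / Real.sqrt 2 : ℝ) : ℂ) = 1 / 2 := by
  rw [← Complex.ofReal_mul, div_mul_div_comm, one_mul, Real.mul_self_sqrt (by norm_num)]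
  norm_num

lemma KMat_mul_jMat_mul_conjTranspose : KMat p * jMat p * (KMat p)ᴴ = JMat p := by
  rw [KMat, conjTranspose_smul, Matrix.smul_mul, Matrix.smul_mul, Matrix.mul_smul, smul_smul,
    Complex.star_def, Complex.conj_ofReal, one_div_sqrt_two_mul_self]
  simp only [jMat, JMat, fromBlocks_conjTranspose, fromBlocks_multiply, fromBlocks_smul]
  congr 1 <;> simp [← two_smul ℂ (1 : Matrix (Fin p) (Fin p) ℂ), smul_smul]

lemma KMat_conjTranspose_mul : (KMat p)ᴴ * KMat p = 1 := by
  rw [KMat, conjTranspose_smul, Matrix.smul_mul, Matrix.mul_smul, smul_smul,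
    Complex.star_def, Complex.conj_ofReal, one_div_sqrt_two_mul_self]
  simp only [fromBlocks_conjTranspose, fromBlocks_multiply, fromBlocks_smul, ← fromBlocks_one]
  congr 1 <;> simp [← two_smul ℂ (1 : Matrix (Fin p) (Fin p) ℂ), smul_smul]

lemma IsPotential.isHermitian (hC : IsPotential N C) {k : ℕ} (hk : k ≤ N) :
    (C k).IsHermitian := by
  obtain ⟨β, hβ⟩ := hC
  rw [(hβ k hk).1, Matrix.mul_assoc _ (β k), ← conjTranspose_mul]
  have hj : (jMat p).IsHermitian := signatureMatrix_conjTranspose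
  exact ((isHermitian_conjTranspose_mul_self _).smul (by simp [IsSelfAdjoint])).sub hj

lemma IsPotential.isFundamentalProjection (hC : IsPotential N C) {k : ℕ} (hk : k ≤ N) :
    IsFundamentalProjection (jMat p) (potentialProj (C k)) := by
  obtain ⟨β, hβ⟩ := hC
  obtain ⟨hCk, hβk⟩ := hβ k hk
  set V := (β k * KMat p)ᴴ with hV
  have hVj : Vᴴ * jMat p * V = 1 := by
    rw [hV, conjTranspose_conjTranspose, conjTranspose_mul, ← hβk,
      ← KMat_mul_jMat_mul_conjTranspose]
    simp only [Matrix.mul_assoc]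
  have hproj : potentialProj (C k) = V * Vᴴ * jMat p := by
    rw [potentialProj, hCk, hV, sub_mul, jMat_mul_jMat, add_sub_cancel, smul_mul_assoc,
      inv_smul_smul₀ two_ne_zero, conjTranspose_conjTranspose, conjTranspose_mul]
    simp only [Matrix.mul_assoc]
  rw [hproj]
  exact isFundamentalProjection_mul_conjTranspose_mul hVj

end Potential

section SpectralParameter

/-- The Möbius map `z ↦ i (z + 1) / (z - 1)` from the unit disk onto the lower half-plane. -/
noncomputable def diskToLowerHalfPlane (z : ℂ) : ℂ := Complex.I * ((z + 1) / (z - 1))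

lemma diskToLowerHalfPlane_zero : diskToLowerHalfPlane 0 = -Complex.I := by
  simp [diskToLowerHalfPlane]

lemma analyticAt_diskToLowerHalfPlane : AnalyticAt ℂ diskToLowerHalfPlane 0 := by
  unfold diskToLowerHalfPlane
  exact analyticAt_const.mul ((analyticAt_id.add analyticAt_const).div
    (analyticAt_id.sub analyticAt_const) (by simp))

lemma eventually_sub_one_ne_zero_and_add_one_ne_zero :
    ∀ᶠ z : ℂ in 𝓝 0, z - 1 ≠ 0 ∧ z + 1 ≠ 0 :=
  ((continuous_sub_right 1).continuousAt.eventually_ne (by simp)).and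
    ((continuous_add_const 1).continuousAt.eventually_ne (by simp))

lemma tendsto_diskToLowerHalfPlane_nhdsNE :
    Tendsto diskToLowerHalfPlane (𝓝[≠] 0) (𝓝[≠] (-Complex.I)) := by
  rw [← diskToLowerHalfPlane_zero]
  refine tendsto_nhdsWithin_iff.2
    ⟨analyticAt_diskToLowerHalfPlane.continuousAt.tendsto.mono_left nhdsWithin_le_nhds, ?_⟩
  filter_upwards [self_mem_nhdsWithin,
    eventually_sub_one_ne_zero_and_add_one_ne_zero.filter_mono nhdsWithin_le_nhds]
    with z hz0 hz h
  rw [Set.mem_singleton_iff, diskToLowerHalfPlane_zero, diskToLowerHalfPlane,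
    ← mul_neg_one, mul_right_inj' Complex.I_ne_zero, div_eq_iff hz.1] at h
  exact hz0 (by simpa using show (2 : ℂ) * z = 0 by linear_combination h)

lemma continuousAt_comp_diskToLowerHalfPlane {F : Type*} [TopologicalSpace F] {f : ℂ → F}
    (hf : ContinuousAt f (-Complex.I)) : ContinuousAt (fun z => f (diskToLowerHalfPlane z)) 0 :=
  ContinuousAt.comp (by rwa [diskToLowerHalfPlane_zero])
    analyticAt_diskToLowerHalfPlane.continuousAt

variable {p n : ℕ} {C : ℕ → BlockMat p} {z : ℂ}

lemma one_add_smul_mul_jMat (C : BlockMat p) (hz : z + 1 ≠ 0) :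
    1 + ((z - 1) / (z + 1)) • (C * jMat p) =
      (2 / (z + 1)) • potapovFactor (potentialProj C) z := by
  rw [potapovFactor, potentialProj]
  match_scalars <;> field_simp <;> ring

lemma conjTranspose_fundSol (hC : ∀ k < n, (C k).IsHermitian) (hz₁ : z - 1 ≠ 0)
    (hz₂ : z + 1 ≠ 0) :
    (fundSol C (starRingEnd ℂ (diskToLowerHalfPlane z)) n)ᴴ =
      (2 / (z + 1)) ^ n • potapovProd (fun k => potentialProj (C k)) n z := by
  induction n with
  | zero => simp [fundSol, potapovProd]
  | succ n ih =>
    have hstar : star (Complex.I / starRingEnd ℂ (diskToLowerHalfPlane z)) =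
        -((z - 1) / (z + 1)) := by
      simp only [Complex.star_def, map_div₀, Complex.conj_conj, Complex.conj_I,
        diskToLowerHalfPlane]
      field_simp
    have hj : (jMat p)ᴴ = jMat p := signatureMatrix_conjTranspose
    rw [fundSol, conjTranspose_sub, conjTranspose_smul, conjTranspose_mul, conjTranspose_mul,
      (hC n n.lt_succ_self).eq, hj, hstar, neg_smul, sub_neg_eq_add, ← Matrix.mul_smul,
      ← mul_one_add, one_add_smul_mul_jMat _ hz₂,
      ih fun k hk => hC k (hk.trans n.lt_succ_self), Matrix.mul_smul, Matrix.smul_mul, smul_smul,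
      ← pow_succ', potapovProd_succ]

lemma mobiusCoeff_diskToLowerHalfPlane {N : ℕ} (hC : ∀ k ≤ N, (C k).IsHermitian)
    (hz₁ : z - 1 ≠ 0) (hz₂ : z + 1 ≠ 0) :
    mobiusCoeff C N (diskToLowerHalfPlane z) =
      (2 / (z + 1)) ^ (N + 1) •
        (KMat p * potapovProd (fun k => potentialProj (C k)) (N + 1) z) := by
  rw [mobiusCoeff, conjTranspose_fundSol (fun k hk => hC k (Nat.le_of_lt_succ hk)) hz₁ hz₂,
    Matrix.mul_smul]

end SpectralParameter

section WeylFunction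

variable {p N : ℕ} {C : ℕ → BlockMat p} {φ : ℂ → Matrix (Fin p) (Fin p) ℂ}

lemma KMat_mul_toRows₁ (V : Matrix (Fin p ⊕ Fin p) (Fin p) ℂ) :
    (KMat p * V).toRows₁ = ((1 / Real.sqrt 2 : ℝ) : ℂ) • (V.toRows₁ - V.toRows₂) := by
  conv_lhs => rw [← fromRows_toRows V, KMat, Matrix.smul_mul, fromBlocks_mul_fromRows]
  simp only [Matrix.one_mul, Matrix.neg_mul, ← sub_eq_add_neg]
  rfl

lemma isUnit_KMat_mul_toRows₁ {P : BlockMat p} (hP : IsFundamentalProjection (jMat p) P)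
    {V : Matrix (Fin p ⊕ Fin p) (Fin p) ℂ} (hV : IsNonposFrame (jMat p) V) (hPV : P * V = 0) :
    IsUnit (KMat p * V).toRows₁ := by
  have hc : ((1 / Real.sqrt 2 : ℝ) : ℂ) ≠ 0 := by simp
  rw [KMat_mul_toRows₁]
  exact (IsFundamentalProjection.isUnit_toRows₁_sub_toRows₂ hP hV hPV).smul (Units.mk0 _ hc)

lemma PairIneq.isNonposFrame {R Q : Matrix (Fin p) (Fin p) ℂ} (h : PairIneq R Q) :
    IsNonposFrame (jMat p) (fromRows R Q) where
  mulVec_injective := by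
    refine (injective_iff_map_eq_zero (fromRows R Q).mulVecLin).2 fun v hv => ?_
    rw [mulVecLin_apply, fromRows_mulVec] at hv
    have hR : R *ᵥ v = 0 := funext fun i => congrFun hv (Sum.inl i)
    have hQ : Q *ᵥ v = 0 := funext fun i => congrFun hv (Sum.inr i)
    by_contra hne
    refine (h.1.dotProduct_mulVec_pos hne).ne' ?_
    rw [add_mulVec, ← mulVec_mulVec, ← mulVec_mulVec, hR, hQ, mulVec_zero, mulVec_zero, add_zero,
      dotProduct_zero]
  posSemidef_neg := by
    have hform := conjTranspose_mul_signatureMatrix_mul (fromRows R Q)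
    rw [toRows₁_fromRows, toRows₂_fromRows] at hform
    rw [jMat, hform, neg_sub]
    exact h.2

lemma lowerHalfPlane_mem_nhds_neg_I : lowerHalfPlane ∈ 𝓝 (-Complex.I) :=
  (isOpen_lt Complex.continuous_im continuous_const).mem_nhds (by simp)

/-- The part of the definition of a Weyl function that is visible near `-i`, the point where the
Taylor coefficients are taken: `φ` is analytic at `-i`, and near `-i` it is represented by a pair
`R`, `Q` which is merely continuous at `-i` and satisfies the required inequalities there. -/
structure IsWeylGerm (C : ℕ → BlockMat p) (N : ℕ) (φ : ℂ → Matrix (Fin p) (Fin p) ℂ) : Prop where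
  analyticAt : ∀ a b, AnalyticAt ℂ (fun μ => φ μ a b) (-Complex.I)
  exists_pair : ∃ R Q : ℂ → Matrix (Fin p) (Fin p) ℂ,
    ContinuousAt R (-Complex.I) ∧ ContinuousAt Q (-Complex.I) ∧
    PairIneq (R (-Complex.I)) (Q (-Complex.I)) ∧
    ∀ᶠ μ in 𝓝[≠] (-Complex.I),
      φ μ = Complex.I • blockQuotient (mobiusCoeff C N μ * fromRows (R μ) (Q μ))

lemma IsWeylFunction.isWeylGerm (hφ : IsWeylFunction C N φ) : IsWeylGerm C N φ := by
  obtain ⟨hdiff, R, Q, hRQ, hrep⟩ := hφ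
  refine ⟨fun a b => (hdiff a b).analyticAt lowerHalfPlane_mem_nhds_neg_I, R, Q,
    continuousAt_pi.2 fun a => continuousAt_pi.2 fun b => (hRQ.analytic_R a b).continuousAt,
    continuousAt_pi.2 fun a => continuousAt_pi.2 fun b => (hRQ.analytic_Q a b).continuousAt,
    hRQ.ineq_at, ?_⟩
  simp only [blockQuotient_mul_fromRows]
  exact hrep.filter_mono (nhdsNE_le_codiscreteWithin lowerHalfPlane_mem_nhds_neg_I)

/-- If `Y` is the product applied to the pair `R`, `Q`, then `-i φ` is the block quotient of `K Y`
and `D` its upper block. -/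
lemma IsWeylGerm.exists_potapovProd_mul_eq (hφ : IsWeylGerm C N φ) (hC : IsPotential N C) :
    ∃ (X : ℂ → Matrix (Fin p ⊕ Fin p) (Fin p) ℂ) (D : ℂ → Matrix (Fin p) (Fin p) ℂ),
      ContinuousAt X 0 ∧ ContinuousAt D 0 ∧ IsNonposFrame (jMat p) (X 0) ∧ IsUnit (D 0) ∧
      ∀ᶠ z in 𝓝[≠] 0, potapovProd (fun k => potentialProj (C k)) (N + 1) z * X z =
        (KMat p)ᴴ * fromRows (1 : Matrix (Fin p) (Fin p) ℂ)
          (-(Complex.I • φ (diskToLowerHalfPlane z))) * D z := by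
  obtain ⟨-, R, Q, hR, hQ, hRQ, hrep⟩ := hφ
  set X := fun z => fromRows (R (diskToLowerHalfPlane z)) (Q (diskToLowerHalfPlane z))
  set P := fun k => potentialProj (C k)
  set Z := fun z => KMat p * (potapovProd P (N + 1) z * X z)
  have hXc : ContinuousAt X 0 := continuousAt_fromRows (continuousAt_comp_diskToLowerHalfPlane hR)
    (continuousAt_comp_diskToLowerHalfPlane hQ)
  have hX : IsNonposFrame (jMat p) (X 0) := by
    simpa only [X, diskToLowerHalfPlane_zero] using hRQ.isNonposFrame
  have hPc := (continuous_potapovProd P (N + 1)).continuousAt (x := 0)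
  have hDc : ContinuousAt (fun z => (Z z).toRows₁) 0 := continuousAt_toRows₁ (by fun_prop)
  have hD : IsUnit (Z 0).toRows₁ :=
    have hP : ∀ k < N + 1, IsFundamentalProjection (jMat p) (P k) := fun k hk =>
      hC.isFundamentalProjection (Nat.le_of_lt_succ hk)
    isUnit_KMat_mul_toRows₁ (hP 0 N.succ_pos)
      (hX.potapovProd_zero_mul isUnit_signatureMatrix hP)
      (potapovProd_succ_zero_mul (hP 0 N.succ_pos).isIdempotentElem N _)
  refine ⟨X, fun z => (Z z).toRows₁, hXc, hDc, hX, hD, ?_⟩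
  filter_upwards [tendsto_diskToLowerHalfPlane_nhdsNE.eventually hrep,
    (eventually_isUnit_of_continuousAt hDc hD).filter_mono nhdsWithin_le_nhds,
    eventually_sub_one_ne_zero_and_add_one_ne_zero.filter_mono nhdsWithin_le_nhds]
    with z hz hDz hz'
  have hquot : -(Complex.I • φ (diskToLowerHalfPlane z)) = blockQuotient (Z z) := by
    rw [hz, mobiusCoeff_diskToLowerHalfPlane (fun k => hC.isHermitian) hz'.1 hz'.2,
      Matrix.smul_mul, Matrix.mul_assoc,
      blockQuotient_smul (pow_ne_zero _ (div_ne_zero two_ne_zero hz'.2)) hDz, smul_smul,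
      Complex.I_mul_I, neg_smul, one_smul, neg_neg]
  rw [hquot, Matrix.mul_assoc, fromRows_one_blockQuotient_mul hDz, ← Matrix.mul_assoc,
    KMat_conjTranspose_mul, Matrix.one_mul]

lemma exists_eq_add_pow_smul_of_taylorCoeff_eq {φ₁ φ₂ : ℂ → Matrix (Fin p) (Fin p) ℂ} {n : ℕ}
    (h₁ : ∀ a b, AnalyticAt ℂ (fun μ => φ₁ μ a b) (-Complex.I))
    (h₂ : ∀ a b, AnalyticAt ℂ (fun μ => φ₂ μ a b) (-Complex.I))
    (h : ∀ k < n, taylorCoeff φ₁ k = taylorCoeff φ₂ k) :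
    ∃ G : ℂ → Matrix (Fin p) (Fin p) ℂ, ContinuousAt G 0 ∧ ∀ᶠ z in 𝓝 0,
      Complex.I • φ₁ (diskToLowerHalfPlane z) =
        Complex.I • φ₂ (diskToLowerHalfPlane z) + z ^ n • G z := by
  have hcomp {f : ℂ → ℂ} (hf : AnalyticAt ℂ f (-Complex.I)) :
      AnalyticAt ℂ (fun z => Complex.I * f (diskToLowerHalfPlane z)) 0 :=
    analyticAt_const.mul <| AnalyticAt.comp (by rwa [diskToLowerHalfPlane_zero])
      analyticAt_diskToLowerHalfPlane
  have hentry (a b : Fin p) := exists_eq_add_pow_smul_of_iteratedDeriv_eq (n := n)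
    (hcomp (h₁ a b)) (hcomp (h₂ a b)) fun i hi =>
      (div_left_inj' (Nat.cast_ne_zero.2 i.factorial_ne_zero)).1 (congr_fun₂ (h i hi) a b)
  choose e he heq using hentry
  refine ⟨fun z => of fun a b => e a b z,
    continuousAt_pi.2 fun a => continuousAt_pi.2 fun b => (he a b).continuousAt, ?_⟩
  filter_upwards [eventually_all.2 fun a => eventually_all.2 fun b => heq a b] with z hz
  ext a b
  simpa only [sub_zero, Matrix.add_apply, Matrix.smul_apply, of_apply, smul_eq_mul] using hz a b

end WeylFunction

end DiscreteDirac

open DiscreteDirac Matrix in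
theorem mainTheorem5_general (p N N₁ N₂ : ℕ) (C₁ C₂ : ℕ → BlockMat p) (hC₁ : IsPotential N₁ C₁)
    (hC₂ : IsPotential N₂ C₂) (φ₁ φ₂ : ℂ → Matrix (Fin p) (Fin p) ℂ) (hφ₁ : IsWeylGerm C₁ N₁ φ₁)
    (hφ₂ : IsWeylGerm C₂ N₂ φ₂) (hN : N ≤ min N₁ N₂)
    (hα : ∀ k ≤ N, taylorCoeff φ₁ k = taylorCoeff φ₂ k) : ∀ k ≤ N, C₁ k = C₂ k := by
  obtain ⟨X₁, D₁, hX₁c, hD₁c, hX₁, hD₁, h₁⟩ := hφ₁.exists_potapovProd_mul_eq hC₁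
  obtain ⟨X₂, D₂, hX₂c, hD₂c, -, hD₂, h₂⟩ := hφ₂.exists_potapovProd_mul_eq hC₂
  obtain ⟨G, hGc, hG⟩ := exists_eq_add_pow_smul_of_taylorCoeff_eq hφ₁.analyticAt hφ₂.analyticAt
    fun k hk => hα k (Nat.le_of_lt_add_one hk)
  have hUc := (continuousAt_nonsing_inv hD₁c hD₁).fun_mul hD₂c
  have hEc : ContinuousAt (fun z => (KMat p)ᴴ * fromRows (0 : Matrix (Fin p) (Fin p) ℂ) (G z) *
      D₂ z) 0 := by
    have hrows := continuousAt_fromRows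
      (continuousAt_const (x := (0 : ℂ)) (y := (0 : Matrix (Fin p) (Fin p) ℂ))) hGc
    fun_prop
  refine fun k hk => potentialProj_injective <|
    projection_eq_of_potapovProd_mul_eq (Nat.succ_le_succ (le_min_iff.1 hN).1)
      (Nat.succ_le_succ (le_min_iff.1 hN).2)
      (fun i hi => hC₁.isFundamentalProjection (Nat.le_of_lt_add_one hi))
      (fun i hi => hC₂.isFundamentalProjection (Nat.le_of_lt_add_one hi)) hX₁c hX₂c hUc hEc hX₁
      ((isUnit_nonsing_inv_iff.2 hD₁).mul hD₂) ?_ k (Nat.lt_succ_of_le hk)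
  filter_upwards [h₁, h₂, hG.filter_mono nhdsWithin_le_nhds,
    (eventually_isUnit_of_continuousAt hD₁c hD₁).filter_mono nhdsWithin_le_nhds]
    with z hz₁ hz₂ hGz hDz
  rw [hz₁, hz₂, mul_fromRows_one_mul_eq_add_smul hDz hGz]

theorem mainTheorem5 (p N N₁ N₂ : ℕ)
    (C₁ C₂ : ℕ → DiscreteDirac.BlockMat p)
    (hC₁ : DiscreteDirac.IsPotential N₁ C₁)
    (hC₂ : DiscreteDirac.IsPotential N₂ C₂)
    (φ₁ φ₂ : ℂ → Matrix (Fin p) (Fin p) ℂ)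
    (hφ₁ : DiscreteDirac.IsWeylFunction C₁ N₁ φ₁)
    (hφ₂ : DiscreteDirac.IsWeylFunction C₂ N₂ φ₂)
    (hN : N ≤ min N₁ N₂)
    (hα : ∀ k ≤ N, DiscreteDirac.taylorCoeff φ₁ k = DiscreteDirac.taylorCoeff φ₂ k) :
    ∀ k ≤ N, C₁ k = C₂ k :=
  mainTheorem5_general p N N₁ N₂ C₁ C₂ hC₁ hC₂ φ₁ φ₂ hφ₁.isWeylGerm hφ₂.isWeylGerm hN hα
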